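/- Let $\mathbb K=\mathbb R$ or $\mathbb K=\mathbb C$, and let $a_1,a_2\in\mathbb K$ satisfy $a_1\neq a_2$ and $a_1\neq -a_2$. Then the Painlevé II equations $y''=2y^3+xy+a_1$ and $y''=2y^3+xy+a_2$ are not equivalent under point transformations, not even locally: there are no nonempty open set $U\subseteq\mathbb K^2$ and no smooth (holomorphic if $\mathbb K=\mathbb C$) change of variables $\tilde x=\tilde x(x,y)$, $\tilde y=\tilde y(x,y)$ on $U$ with nowhere vanishing Jacobian determinant that transforms the equation $y''=2y^3+xy+a_1$ over $U$ into the equation $\tilde y''=2\tilde y^3+\tilde x\tilde y+a_2$. Here "transforms" means: for all $(x,y)\in U$ and all values $y',y''\in\mathbb K$ with $\frac{d\tilde x}{dx}=\tilde x_x+y'\tilde x_y\neq 0$, the first equation holds for $(x,y,y',y'')$ if and only if the second holds for $\tilde x,\tilde y$ and the derivatives $\tilde y'=\frac{d\tilde y}{d\tilde x}$, $\tilde y''=\frac{d^2\tilde y}{d\tilde x^2}$ computed from $(x,y,y',y'')$ by the chain rule. -/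

import Mathlib

open scoped ContDiff

/-- An ordinary differential equation
`y'' = P(x,y) + 3 Q(x,y) y' + 3 R(x,y) y'^2 + S(x,y) y'^3`,
given by its four coefficient functions on the `(x,y)`-plane. -/
structure CubicODE (𝕜 : Type*) where
  P : 𝕜 × 𝕜 → 𝕜
  Q : 𝕜 × 𝕜 → 𝕜
  R : 𝕜 × 𝕜 → 𝕜
  S : 𝕜 × 𝕜 → 𝕜

/-- The right-hand side of the equation at the point `z = (x,y)`, with `y' = p`. -/
def CubicODE.rhs {𝕜 : Type*} [RCLike 𝕜] (E : CubicODE 𝕜) (z : 𝕜 × 𝕜) (p : 𝕜) : 𝕜 :=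
  E.P z + 3 * E.Q z * p + 3 * E.R z * p ^ 2 + E.S z * p ^ 3

/-- The second Painlevé equation `y'' = 2 y^3 + x y + a`. -/
def painleveII {𝕜 : Type*} [RCLike 𝕜] (a : 𝕜) : CubicODE 𝕜 where
  P z := 2 * z.2 ^ 3 + z.1 * z.2 + a
  Q _ := 0
  R _ := 0
  S _ := 0

/-- First total derivative of a change of variables `Φ = (x̃, ỹ)`: the pair
`(dx̃/dx, dỹ/dx)` along a graph through `z = (x,y)` with slope `y' = p`. -/
noncomputable def totalDeriv {𝕜 : Type*} [RCLike 𝕜] (Φ : 𝕜 × 𝕜 → 𝕜 × 𝕜)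
    (z : 𝕜 × 𝕜) (p : 𝕜) : 𝕜 × 𝕜 :=
  fderiv 𝕜 Φ z (1, p)

/-- Second total derivative of `Φ = (x̃, ỹ)`: the pair `(d²x̃/dx², d²ỹ/dx²)` along a graph through
`z = (x,y)` with `y' = p` and `y'' = q`, that is,
`Φ_xx + 2 p Φ_xy + p² Φ_yy + q Φ_y`. -/
noncomputable def totalDeriv₂ {𝕜 : Type*} [RCLike 𝕜] (Φ : 𝕜 × 𝕜 → 𝕜 × 𝕜)
    (z : 𝕜 × 𝕜) (p q : 𝕜) : 𝕜 × 𝕜 :=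
  fderiv 𝕜 (fderiv 𝕜 Φ) z (1, p) (1, p) + fderiv 𝕜 Φ z (0, q)

/-- The value of `dỹ/dx̃` in the new variables (meaningful where `dx̃/dx ≠ 0`). -/
noncomputable def newSlope {𝕜 : Type*} [RCLike 𝕜] (Φ : 𝕜 × 𝕜 → 𝕜 × 𝕜)
    (z : 𝕜 × 𝕜) (p : 𝕜) : 𝕜 :=
  (totalDeriv Φ z p).2 / (totalDeriv Φ z p).1

/-- The value of `d²ỹ/dx̃²` in the new variables (meaningful where `dx̃/dx ≠ 0`). -/
noncomputable def newSecond {𝕜 : Type*} [RCLike 𝕜] (Φ : 𝕜 × 𝕜 → 𝕜 × 𝕜)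
    (z : 𝕜 × 𝕜) (p q : 𝕜) : 𝕜 :=
  ((totalDeriv₂ Φ z p q).2 * (totalDeriv Φ z p).1
      - (totalDeriv Φ z p).2 * (totalDeriv₂ Φ z p q).1) / (totalDeriv Φ z p).1 ^ 3

/-- A point transformation `(x,y) ↦ (x̃(x,y), ỹ(x,y))` on an open set `U` of the plane: smooth
(holomorphic when `𝕜 = ℂ`) and with nowhere vanishing Jacobian determinant. -/
structure IsPointTransformation {𝕜 : Type*} [RCLike 𝕜] (Φ : 𝕜 × 𝕜 → 𝕜 × 𝕜)
    (U : Set (𝕜 × 𝕜)) : Prop where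
  isOpen : IsOpen U
  contDiffOn : ContDiffOn 𝕜 ∞ Φ U
  det_ne_zero : ∀ z ∈ U, (fderiv 𝕜 Φ z).det ≠ 0

/-- `Φ` carries the equation `E₁` over `U` to the equation `E₂`: for every `(x,y) ∈ U` and all values
`p`, `q` of `y'`, `y''` for which `x̃` can serve as the new independent variable, the equation
`E₁` holds for `(x,y,p,q)` if and only if `E₂` holds for the transformed values. -/
def Transforms {𝕜 : Type*} [RCLike 𝕜] (Φ : 𝕜 × 𝕜 → 𝕜 × 𝕜) (U : Set (𝕜 × 𝕜))
    (E₁ E₂ : CubicODE 𝕜) : Prop :=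
  ∀ z ∈ U, ∀ p q : 𝕜, (totalDeriv Φ z p).1 ≠ 0 →
    (q = E₁.rhs z p ↔ newSecond Φ z p q = E₂.rhs (Φ z) (newSlope Φ z p))

/-- Two equations are (locally) equivalent under point transformations if some point transformation,
defined on a nonempty open subset of the plane, carries the first to the second. -/
def PointEquivalent {𝕜 : Type*} [RCLike 𝕜] (E₁ E₂ : CubicODE 𝕜) : Prop :=
  ∃ (U : Set (𝕜 × 𝕜)) (Φ : 𝕜 × 𝕜 → 𝕜 × 𝕜),
    U.Nonempty ∧ IsPointTransformation Φ U ∧ Transforms Φ U E₁ E₂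

/-!
Write `(u, v)` for the new variables and `J` for their Jacobian determinant. Once `y''` is
eliminated, the transformed equation is a cubic polynomial in `y'` that must vanish identically. Its
four coefficients express all second derivatives of `u` and `v` through their first derivatives,
`s = J_x / (3 J)` and `t = J_y / (3 J)`. Let `F` be the new right-hand side. Equality of the mixed
derivatives of `J`, of `u_y` and `v_y`, and of `t` gives in turn `s_y = t_x`, formulas for `t_x` and
`t_y`, and `F_vv u_y = 0`. For Painlevé II the last equation is `v u_y = 0`, and differentiating it
gives `J u_y = 0`, so `u` depends on `x` only.

Then `t = 0` and `v_yy = 0`, and three differentiations of the remaining equation in `y` lead to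
`(v_y u_x)² = 1` and `v = y v_y`. Differentiating the former in `x` gives `s = 0`, and the
lower-order terms in `y` then give `u_x³ = 1` and `a₁ v_y u_x = a₂`, hence `a₁² = a₂²`.
-/

section DifferentialAlgebra

variable {R A : Type*} [CommRing R] [CommRing A] [Algebra R A] {Dx Dy : Derivation R A A}
  {u v f F s t G H : A}

theorem derivation_ofNat (D : Derivation R A A) (n : ℕ) [n.AtLeastTwo] : D (ofNat(n) : A) = 0 :=
  D.map_natCast n

/-- The Jacobian determinant of the pair `(u, v)` with respect to the derivations `Dx` and `Dy`,
which stand for `∂/∂x` and `∂/∂y`. -/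
def jacobian (Dx Dy : Derivation R A A) (u v : A) : A :=
  Dx u * Dy v - Dy u * Dx v

/-- The determining equations for `(x, y) ↦ (u, v)` to carry `y'' = f` to `v'' = F`, where `f` and
`F` are free of first derivatives and both regarded as functions of `(x, y)`. They say that the
transformed equation holds identically in `y'`, that is, that this cubic in `y'` vanishes. -/
def determiningCubic (Dx Dy : Derivation R A A) (u v f F : A) : Cubic A where
  a := Dy (Dy v) * Dy u - Dy v * Dy (Dy u) - F * Dy u ^ 3
  b := Dy (Dy v) * Dx u + 2 * Dx (Dy v) * Dy u - Dx v * Dy (Dy u) - 2 * Dy v * Dx (Dy u)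
    - 3 * F * Dx u * Dy u ^ 2
  c := 2 * Dx (Dy v) * Dx u + Dx (Dx v) * Dy u - 2 * Dx v * Dx (Dy u) - Dy v * Dx (Dx u)
    - 3 * F * Dx u ^ 2 * Dy u
  d := Dx (Dx v) * Dx u - Dx v * Dx (Dx u) + f * jacobian Dx Dy u v - F * Dx u ^ 3

/-- The determining equations solved for the second derivatives of `u` and `v`. The auxiliary
unknowns `s` and `t` are the first derivatives of the Jacobian `J` divided by `3 * J`. -/
structure HessianEqs (Dx Dy : Derivation R A A) (u v f F s t : A) : Prop where
  dxx_fst : Dx (Dx u) = 2 * s * Dx u - f * Dy u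
  dxy_fst : Dx (Dy u) = s * Dy u + t * Dx u
  dyy_fst : Dy (Dy u) = 2 * t * Dy u
  dxx_snd : Dx (Dx v) = 2 * s * Dx v - f * Dy v + F * Dx u ^ 2
  dxy_snd : Dx (Dy v) = s * Dy v + t * Dx v + F * (Dx u * Dy u)
  dyy_snd : Dy (Dy v) = 2 * t * Dy v + F * Dy u ^ 2

theorem exists_hessianEqs_of_determiningCubic_eq_zero (h : determiningCubic Dx Dy u v f F = 0)
    (hD : Function.Commute Dx Dy) (h3 : IsUnit (3 : A)) (hJ : IsUnit (jacobian Dx Dy u v)) :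
    ∃ s t, HessianEqs Dx Dy u v f F s t := by
  obtain ⟨i, hi⟩ := (h3.mul hJ).exists_right_inv
  obtain ⟨e₃, e₂, e₁, e₀⟩ := Cubic.ext_iff.mp (h : _ = ⟨0, 0, 0, 0⟩)
  refine ⟨Dx (jacobian Dx Dy u v) * i, Dy (jacobian Dx Dy u v) * i, ?_⟩
  simp only [determiningCubic, jacobian] at e₀ e₁ e₂ e₃ hi
  constructor <;> simp only [jacobian, map_sub, Derivation.leibniz, smul_eq_mul, ← hD.eq]
  · linear_combination i * (3 * Dy u * e₀ - Dx u * e₁) - (Dx (Dx u) + f * Dy u) * hi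
  · linear_combination i * (Dy u * e₁ - Dx u * e₂) - Dx (Dy u) * hi
  · linear_combination i * (Dy u * e₂ - 3 * Dx u * e₃) - Dy (Dy u) * hi
  · linear_combination i * (3 * Dy v * e₀ - Dx v * e₁)
      - (Dx (Dx v) + f * Dy v - F * Dx u ^ 2) * hi
  · linear_combination i * (Dy v * e₁ - Dx v * e₂) - (Dx (Dy v) - F * Dx u * Dy u) * hi
  · linear_combination i * (Dy v * e₂ - 3 * Dx v * e₃) - (Dy (Dy v) - F * Dy u ^ 2) * hi

namespace HessianEqs

theorem dx_jacobian (h : HessianEqs Dx Dy u v f F s t) :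
    Dx (jacobian Dx Dy u v) = 3 * s * jacobian Dx Dy u v := by
  simp only [jacobian, map_sub, Derivation.leibniz, smul_eq_mul, h.dxx_fst, h.dxy_fst, h.dxx_snd,
    h.dxy_snd]
  ring

theorem dy_fst_eq_zero_of_mul_eq_zero (h : HessianEqs Dx Dy u v f F s t)
    (hH : IsUnit (jacobian Dx Dy u H)) (hHu : H * Dy u = 0) : Dy u = 0 := by
  have hx := congrArg Dx hHu
  have hy := congrArg Dy hHu
  simp only [Derivation.leibniz, smul_eq_mul, h.dxy_fst, h.dyy_fst, map_zero] at hx hy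
  apply hH.mul_left_cancel
  simp only [jacobian]
  linear_combination Dx u * hy - Dy u * hx + (s * Dy u - t * Dx u) * hHu

section Integrability

variable (h : HessianEqs Dx Dy u v f F s t) (hD : Function.Commute Dx Dy)
include h hD

theorem dy_jacobian : Dy (jacobian Dx Dy u v) = 3 * t * jacobian Dx Dy u v := by
  simp only [jacobian, map_sub, Derivation.leibniz, smul_eq_mul, ← hD.eq, h.dyy_fst, h.dxy_fst,
    h.dyy_snd, h.dxy_snd]
  ring

theorem dx_t_mul_dy_fst (hst : Dy s = Dx t) :
    (Dx t - s * t) * Dy u = (Dy t - t ^ 2) * Dx u := by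
  have hmixed := hD.eq (Dy u)
  simp only [h.dxy_fst, h.dyy_fst, ← hD.eq u, hst, map_add, Derivation.leibniz, smul_eq_mul,
    derivation_ofNat] at hmixed
  linear_combination hmixed

theorem dx_t_mul_dy_snd (hst : Dy s = Dx t) :
    (Dx t - s * t) * Dy v = (Dy t - t ^ 2) * Dx v + jacobian Dx Dy u F * Dy u := by
  have hmixed := hD.eq (Dy v)
  simp only [h.dxy_fst, h.dyy_fst, h.dxy_snd, h.dyy_snd, ← hD.eq u, ← hD.eq v, hst, map_add,
    Derivation.leibniz, Derivation.leibniz_pow, smul_eq_mul, derivation_ofNat,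
    nsmul_eq_mul] at hmixed
  simp only [jacobian]
  linear_combination hmixed

variable (h3 : IsUnit (3 : A)) (hJ : IsUnit (jacobian Dx Dy u v))
include h3 hJ

theorem dy_s_eq_dx_t : Dy s = Dx t := by
  have hmixed := hD.eq (jacobian Dx Dy u v)
  simp only [h.dx_jacobian, h.dy_jacobian hD, Derivation.leibniz, smul_eq_mul,
    derivation_ofNat] at hmixed
  apply (h3.mul hJ).mul_left_cancel
  linear_combination -hmixed

variable (hF : jacobian Dx Dy u F = G * jacobian Dx Dy u v)
include hF

theorem dx_t : Dx t = s * t + G * (Dx u * Dy u) := by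
  have hst := h.dy_s_eq_dx_t hD h3 hJ
  have hu := h.dx_t_mul_dy_fst hD hst
  have hv := h.dx_t_mul_dy_snd hD hst
  rw [hF] at hv
  apply hJ.mul_left_cancel
  simp only [jacobian] at hv ⊢
  linear_combination Dx u * hv - Dx v * hu

theorem dy_t : Dy t = t ^ 2 + G * Dy u ^ 2 := by
  have hst := h.dy_s_eq_dx_t hD h3 hJ
  have hu := h.dx_t_mul_dy_fst hD hst
  have hv := h.dx_t_mul_dy_snd hD hst
  rw [hF] at hv
  apply hJ.mul_left_cancel
  simp only [jacobian] at hv ⊢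
  linear_combination Dy u * hv - Dy v * hu

theorem jacobian_mul_dy_fst_eq_zero : jacobian Dx Dy u G * Dy u = 0 := by
  have hmixed := hD.eq t
  simp only [h.dx_t hD h3 hJ hF, h.dy_t hD h3 hJ hF, h.dxy_fst, h.dyy_fst, ← hD.eq u,
    h.dy_s_eq_dx_t hD h3 hJ, map_add, Derivation.leibniz, Derivation.leibniz_pow, smul_eq_mul,
    nsmul_eq_mul] at hmixed
  simp only [jacobian]
  linear_combination -hmixed

end Integrability

end HessianEqs

/-- The solved determining equations for a fibre-preserving transformation, that is, one whose new
independent variable `u` does not depend on `y`. -/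
structure FiberPreservingEqs (Dx Dy : Derivation R A A) (u v f F s : A) : Prop where
  isUnit_dx_fst : IsUnit (Dx u)
  isUnit_dy_snd : IsUnit (Dy v)
  dy_fst : Dy u = 0
  dy_s : Dy s = 0
  dxx_fst : Dx (Dx u) = 2 * s * Dx u
  dxx_snd : Dx (Dx v) = 2 * s * Dx v - f * Dy v + F * Dx u ^ 2
  dxy_snd : Dx (Dy v) = s * Dy v
  dyy_snd : Dy (Dy v) = 0

theorem HessianEqs.fiberPreservingEqs (h : HessianEqs Dx Dy u v f F s t)
    (hD : Function.Commute Dx Dy) (h3 : IsUnit (3 : A)) (hJ : IsUnit (jacobian Dx Dy u v))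
    (hu : Dy u = 0) : FiberPreservingEqs Dx Dy u v f F s := by
  have hst := h.dy_s_eq_dx_t hD h3 hJ
  obtain ⟨hdx, hdy⟩ : IsUnit (Dx u) ∧ IsUnit (Dy v) := by
    simpa only [jacobian, hu, zero_mul, sub_zero, IsUnit.mul_iff] using hJ
  have ht : t = 0 := hdx.mul_left_eq_zero.mp (by simpa [hu] using h.dxy_fst.symm)
  obtain ⟨hxx, -, -, kxx, kxy, kyy⟩ := h
  constructor <;> simp_all

namespace FiberPreservingEqs

variable (h : FiberPreservingEqs Dx Dy u v f F s) (hD : Function.Commute Dx Dy)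
include h hD

theorem dy_dx_fst : Dy (Dx u) = 0 := by
  rw [← hD.eq, h.dy_fst, map_zero]

theorem dy_source : Dy f * Dy v = Dy F * Dx u ^ 2 + (s ^ 2 - Dx s) * Dy v := by
  have hmixed := hD.eq (Dx v)
  simp only [h.dxx_snd, ← hD.eq v, h.dxy_snd, h.dyy_snd, h.dy_s, h.dy_dx_fst hD, map_add, map_sub,
    Derivation.leibniz, Derivation.leibniz_pow, smul_eq_mul, nsmul_eq_mul,
    derivation_ofNat] at hmixed
  linear_combination hmixed

theorem dyy_source : Dy (Dy f) * Dy v = Dy (Dy F) * Dx u ^ 2 := by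
  have hdiff := congrArg Dy (h.dy_source hD)
  simp only [h.dyy_snd, h.dy_s, h.dy_dx_fst hD, ← hD.eq s, map_add, map_sub, map_zero,
    Derivation.leibniz, Derivation.leibniz_pow, smul_eq_mul, nsmul_eq_mul] at hdiff
  linear_combination hdiff

end FiberPreservingEqs

section Painleve

/-- The right-hand side `2 y³ + x y + a` of the second Painlevé equation, over an arbitrary algebra
so that `x` and `y` may be either the coordinates or the components of a transformation. -/
def painleveIIRhs (x y : A) (a : R) : A :=
  2 * y ^ 3 + x * y + algebraMap R A a

/-- `x` and `y` behave as the coordinate functions for the derivations `Dx` and `Dy`. -/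
structure IsCoordinatePair (Dx Dy : Derivation R A A) (x y : A) : Prop where
  dx_fst : Dx x = 1
  dx_snd : Dx y = 0
  dy_fst : Dy x = 0
  dy_snd : Dy y = 1

theorem derivation_painleveIIRhs (D : Derivation R A A) (x y : A) (a : R) :
    D (painleveIIRhs x y a) = (6 * y ^ 2 + x) * D y + y * D x := by
  simp only [painleveIIRhs, map_add, Derivation.leibniz, Derivation.leibniz_pow, smul_eq_mul,
    nsmul_eq_mul, derivation_ofNat, Derivation.map_algebraMap]
  push_cast
  ring

theorem jacobian_painleveIIRhs (a : R) :
    jacobian Dx Dy u (painleveIIRhs u v a) = (6 * v ^ 2 + u) * jacobian Dx Dy u v := by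
  simp only [jacobian, derivation_painleveIIRhs]
  ring

theorem isUnit_three_of_isUnit_six (h6 : IsUnit (6 : A)) : IsUnit (3 : A) :=
  isUnit_of_dvd_unit ⟨2, by norm_num⟩ h6

theorem isUnit_twelve_of_isUnit_six (h6 : IsUnit (6 : A)) : IsUnit (12 : A) :=
  isUnit_of_dvd_unit ⟨3, by norm_num⟩ (h6.mul h6)

variable {x y : A} {a a₁ a₂ : R}

theorem HessianEqs.dy_fst_eq_zero_of_painleveII
    (h : HessianEqs Dx Dy u v f (painleveIIRhs u v a) s t) (hD : Function.Commute Dx Dy)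
    (h6 : IsUnit (6 : A)) (hJ : IsUnit (jacobian Dx Dy u v)) : Dy u = 0 := by
  have hG := h.jacobian_mul_dy_fst_eq_zero hD (isUnit_three_of_isUnit_six h6) hJ
    (jacobian_painleveIIRhs a)
  refine h.dy_fst_eq_zero_of_mul_eq_zero hJ
    (((isUnit_twelve_of_isUnit_six h6).mul hJ).mul_left_cancel ?_)
  simp only [jacobian, map_add, Derivation.leibniz, Derivation.leibniz_pow, smul_eq_mul,
    nsmul_eq_mul, derivation_ofNat] at hG ⊢
  linear_combination hG

namespace FiberPreservingEqs

variable (h : FiberPreservingEqs Dx Dy u v (painleveIIRhs x y a₁) (painleveIIRhs u v a₂) s)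
  (hD : Function.Commute Dx Dy) (h6 : IsUnit (6 : A)) (hxy : IsCoordinatePair Dx Dy x y)
include h hD h6 hxy

theorem eq_snd_mul : y = v * (Dy v * Dx u ^ 2) := by
  have hdiff := h.dyy_source hD
  simp only [derivation_painleveIIRhs, hxy.dy_fst, hxy.dy_snd, h.dy_fst, h.dyy_snd, map_add,
    Derivation.leibniz, Derivation.leibniz_pow, smul_eq_mul, nsmul_eq_mul, derivation_ofNat,
    map_zero, Derivation.map_one_eq_zero] at hdiff
  apply ((isUnit_twelve_of_isUnit_six h6).mul h.isUnit_dy_snd).mul_left_cancel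
  linear_combination hdiff

theorem sq_mul_sq_eq_one : Dy v ^ 2 * Dx u ^ 2 = 1 := by
  have hdiff := congrArg Dy (h.eq_snd_mul hD h6 hxy)
  simp only [hxy.dy_snd, h.dyy_snd, h.dy_dx_fst hD, Derivation.leibniz, Derivation.leibniz_pow,
    smul_eq_mul, nsmul_eq_mul] at hdiff
  linear_combination -hdiff

theorem snd_eq : v = y * Dy v := by
  linear_combination -v * h.sq_mul_sq_eq_one hD h6 hxy - Dy v * h.eq_snd_mul hD h6 hxy

theorem s_eq_zero : s = 0 := by
  have hone := h.sq_mul_sq_eq_one hD h6 hxy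
  have hdiff := congrArg Dx hone
  simp only [h.dxy_snd, h.dxx_fst, Derivation.leibniz, Derivation.leibniz_pow, smul_eq_mul,
    nsmul_eq_mul, Derivation.map_one_eq_zero] at hdiff
  apply h6.mul_left_cancel
  linear_combination hdiff - 6 * s * hone

theorem dx_snd_eq_zero : Dx v = 0 := by
  rw [h.snd_eq hD h6 hxy, Derivation.leibniz, h.dxy_snd, h.s_eq_zero hD h6 hxy, hxy.dx_snd]
  simp

theorem fst_eq : x = u * Dx u ^ 2 := by
  have hsource := h.dy_source hD
  simp only [derivation_painleveIIRhs, hxy.dy_fst, hxy.dy_snd, h.dy_fst, h.s_eq_zero hD h6 hxy,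
    map_zero] at hsource
  apply h.isUnit_dy_snd.mul_left_cancel
  linear_combination hsource + 6 * y ^ 2 * Dy v * h.sq_mul_sq_eq_one hD h6 hxy
    + 6 * (v + y * Dy v) * Dx u ^ 2 * Dy v * h.snd_eq hD h6 hxy

theorem dx_fst_pow_three : Dx u ^ 3 = 1 := by
  have hdiff := congrArg Dx (h.fst_eq hD h6 hxy)
  simp only [hxy.dx_fst, h.dxx_fst, h.s_eq_zero hD h6 hxy, Derivation.leibniz,
    Derivation.leibniz_pow, smul_eq_mul, nsmul_eq_mul] at hdiff
  linear_combination -hdiff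

theorem dy_snd_sq : Dy v ^ 2 = Dx u := by
  linear_combination Dx u * h.sq_mul_sq_eq_one hD h6 hxy - Dy v ^ 2 * h.dx_fst_pow_three hD h6 hxy

theorem param_mul_eq : algebraMap R A a₁ * (Dy v * Dx u) = algebraMap R A a₂ := by
  have hcube := h.dx_fst_pow_three hD h6 hxy
  have hODE := h.dxx_snd
  simp only [h.dx_snd_eq_zero hD h6 hxy, map_zero, painleveIIRhs] at hODE
  linear_combination Dx u * hODE + (2 * v ^ 3 + u * v + algebraMap R A a₂) * hcube
    + (2 * (v ^ 2 + v * y * Dy v + y ^ 2 * Dy v ^ 2) + u) * h.snd_eq hD h6 hxy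
    + 2 * y ^ 3 * Dy v * h.dy_snd_sq hD h6 hxy
    - y * Dy v * (Dx u * h.fst_eq hD h6 hxy + u * hcube)

theorem param_sq_eq : algebraMap R A a₁ ^ 2 = algebraMap R A a₂ ^ 2 := by
  rw [← h.param_mul_eq hD h6 hxy, mul_pow, mul_pow, h.sq_mul_sq_eq_one hD h6 hxy, mul_one]

end FiberPreservingEqs

theorem param_sq_eq_of_determiningCubic_eq_zero
    (h : determiningCubic Dx Dy u v (painleveIIRhs x y a₁) (painleveIIRhs u v a₂) = 0)
    (hD : Function.Commute Dx Dy) (h6 : IsUnit (6 : A)) (hJ : IsUnit (jacobian Dx Dy u v))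
    (hxy : IsCoordinatePair Dx Dy x y) : algebraMap R A a₁ ^ 2 = algebraMap R A a₂ ^ 2 := by
  have h3 := isUnit_three_of_isUnit_six h6
  obtain ⟨s, t, hHess⟩ := exists_hessianEqs_of_determiningCubic_eq_zero h hD h3 hJ
  have hu := hHess.dy_fst_eq_zero_of_painleveII hD h6 hJ
  exact (hHess.fiberPreservingEqs hD h3 hJ hu).param_sq_eq hD h6 hxy

end Painleve

end DifferentialAlgebra

section SmoothFunctions

open TopologicalSpace (Opens)

variable {𝕜 E : Type*} [NontriviallyNormedField 𝕜] [NormedAddCommGroup E] [NormedSpace 𝕜 E]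

theorem fderiv_fderiv_apply {F : Type*} [NormedAddCommGroup F] [NormedSpace 𝕜 F] {Φ : E → F}
    {U : Set E} (hU : IsOpen U) (hΦ : ContDiffOn 𝕜 ∞ Φ U) (w w' : E) {z : E} (hz : z ∈ U) :
    fderiv 𝕜 (fderiv 𝕜 Φ) z w w' = fderiv 𝕜 (fun x => fderiv 𝕜 Φ x w') z w := by
  have hdiff : DifferentiableAt 𝕜 (fderiv 𝕜 Φ) z :=
    ((hΦ.fderiv_of_isOpen hU (m := ∞) (by simp)).contDiffAt (hU.mem_nhds hz)).differentiableAt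
      (by simp)
  rw [fderiv_clm_apply hdiff (differentiableAt_const _)]
  simp

/-- The algebra of smooth functions on an open set `U`, on which partial derivatives act as
commuting derivations. A smooth function on `U` is encoded as a function on the subtype `U` that is
the restriction of some function smooth on `U`. -/
def smoothFunctions (𝕜 : Type*) {E : Type*} [NontriviallyNormedField 𝕜] [NormedAddCommGroup E]
    [NormedSpace 𝕜 E] (U : Opens E) : Subalgebra 𝕜 (U → 𝕜) where
  carrier := {g | ∃ G : E → 𝕜, ContDiffOn 𝕜 ∞ G U ∧ ∀ z : U, g z = G z}
  mul_mem' := by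
    rintro _ _ ⟨G, hG, hg⟩ ⟨K, hK, hk⟩
    exact ⟨_, hG.mul hK, fun z => congrArg₂ (· * ·) (hg z) (hk z)⟩
  add_mem' := by
    rintro _ _ ⟨G, hG, hg⟩ ⟨K, hK, hk⟩
    exact ⟨_, hG.add hK, fun z => congrArg₂ (· + ·) (hg z) (hk z)⟩
  algebraMap_mem' c := ⟨fun _ => c, contDiffOn_const, fun _ => rfl⟩

namespace smoothFunctions

variable {U : Opens E} {g : smoothFunctions 𝕜 U} {G : E → 𝕜}

/-- The restriction to `U` of a function smooth on `U`. -/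
def ofContDiffOn (G : E → 𝕜) (hG : ContDiffOn 𝕜 ∞ G U) : smoothFunctions 𝕜 U :=
  ⟨fun z => G z, G, hG, fun _ => rfl⟩

/-- Evaluation of smooth functions at a point of `U`. -/
def evalHom (z : U) : smoothFunctions 𝕜 U →+* 𝕜 :=
  (Pi.evalRingHom (fun _ : U => 𝕜) z).comp (smoothFunctions 𝕜 U).subtype

theorem evalHom_apply (z : U) (g : smoothFunctions 𝕜 U) : evalHom z g = g.1 z :=
  rfl

/-- A chosen function on the whole space restricting to `g`; only its values on `U` are
determined by `g`. -/
noncomputable def extension (g : smoothFunctions 𝕜 U) : E → 𝕜 :=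
  g.2.choose

theorem apply_eq_extension (g : smoothFunctions 𝕜 U) (z : U) : g.1 z = extension g z :=
  g.2.choose_spec.2 z

theorem contDiffOn_of_eq (hg : ∀ z : U, g.1 z = G z) : ContDiffOn 𝕜 ∞ G U := by
  obtain ⟨K, hK, hgK⟩ := g.2
  exact hK.congr fun z hz => (hg ⟨z, hz⟩).symm.trans (hgK ⟨z, hz⟩)

theorem contDiffOn_extension (g : smoothFunctions 𝕜 U) : ContDiffOn 𝕜 ∞ (extension g) U :=
  contDiffOn_of_eq (apply_eq_extension g)

theorem differentiableAt_of_eq (hg : ∀ z : U, g.1 z = G z) (z : U) : DifferentiableAt 𝕜 G z :=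
  ((contDiffOn_of_eq hg).contDiffAt (U.isOpen.mem_nhds z.2)).differentiableAt (by simp)

theorem differentiableAt_extension (g : smoothFunctions 𝕜 U) (z : U) :
    DifferentiableAt 𝕜 (extension g) z :=
  differentiableAt_of_eq (apply_eq_extension g) z

theorem fderiv_extension (hg : ∀ z : U, g.1 z = G z) (z : U) :
    fderiv 𝕜 (extension g) z = fderiv 𝕜 G z :=
  Filter.EventuallyEq.fderiv_eq <| Filter.eventuallyEq_of_mem (U.isOpen.mem_nhds z.2)
    fun x hx => (apply_eq_extension g ⟨x, hx⟩).symm.trans (hg ⟨x, hx⟩)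

theorem fderiv_extension_add (g k : smoothFunctions 𝕜 U) (z : U) :
    fderiv 𝕜 (extension (g + k)) z = fderiv 𝕜 (extension g) z + fderiv 𝕜 (extension k) z := by
  rw [← fderiv_add (differentiableAt_extension g z) (differentiableAt_extension k z)]
  exact fderiv_extension (fun x => congrArg₂ (· + ·) (apply_eq_extension g x)
    (apply_eq_extension k x)) z

theorem fderiv_extension_smul (c : 𝕜) (g : smoothFunctions 𝕜 U) (z : U) :
    fderiv 𝕜 (extension (c • g)) z = c • fderiv 𝕜 (extension g) z := by
  rw [← fderiv_const_smul (differentiableAt_extension g z)]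
  exact fderiv_extension (fun x => congrArg (c • ·) (apply_eq_extension g x)) z

theorem fderiv_extension_mul (g k : smoothFunctions 𝕜 U) (z : U) :
    fderiv 𝕜 (extension (g * k)) z =
      g.1 z • fderiv 𝕜 (extension k) z + k.1 z • fderiv 𝕜 (extension g) z := by
  rw [apply_eq_extension g, apply_eq_extension k,
    ← fderiv_mul (differentiableAt_extension g z) (differentiableAt_extension k z)]
  exact fderiv_extension (fun x => congrArg₂ (· * ·) (apply_eq_extension g x)
    (apply_eq_extension k x)) z

/-- The directional derivative of smooth functions on `U`, as a derivation depending linearly on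
the direction. -/
noncomputable def dirDerivation (𝕜 : Type*) {E : Type*} [NontriviallyNormedField 𝕜]
    [NormedAddCommGroup E] [NormedSpace 𝕜 E] (U : Opens E) :
    E →ₗ[𝕜] Derivation 𝕜 (smoothFunctions 𝕜 U) (smoothFunctions 𝕜 U) where
  toFun w := Derivation.mk'
    { toFun g := ofContDiffOn (fun z => fderiv 𝕜 (extension g) z w)
        (((contDiffOn_extension g).fderiv_of_isOpen U.isOpen (m := ∞) (by simp)).clm_apply
          contDiffOn_const)
      map_add' g k := Subtype.ext <| funext fun z =>
        DFunLike.congr_fun (fderiv_extension_add g k z) w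
      map_smul' c g := Subtype.ext <| funext fun z =>
        DFunLike.congr_fun (fderiv_extension_smul c g z) w }
    fun g k => Subtype.ext <| funext fun z => DFunLike.congr_fun (fderiv_extension_mul g k z) w
  map_add' w w' := by
    ext g z
    exact map_add (fderiv 𝕜 (extension g) z) w w'
  map_smul' c w := by
    ext g z
    exact map_smul (fderiv 𝕜 (extension g) z) c w

theorem dirDerivation_apply (hg : ∀ z : U, g.1 z = G z) (w : E) (z : U) :
    (dirDerivation 𝕜 U w g).1 z = fderiv 𝕜 G z w :=
  DFunLike.congr_fun (fderiv_extension hg z) w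

theorem dirDerivation_ofContDiffOn_apply (hG : ContDiffOn 𝕜 ∞ G U) (w : E) (z : U) :
    (dirDerivation 𝕜 U w (ofContDiffOn G hG)).1 z = fderiv 𝕜 G z w :=
  dirDerivation_apply (fun _ => rfl) w z

theorem dirDerivation_dirDerivation_apply (hg : ∀ z : U, g.1 z = G z) (w w' : E) (z : U) :
    (dirDerivation 𝕜 U w (dirDerivation 𝕜 U w' g)).1 z = fderiv 𝕜 (fderiv 𝕜 G) z w w' := by
  rw [dirDerivation_apply (G := fun x => fderiv 𝕜 G x w') (dirDerivation_apply hg w'),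
    fderiv_fderiv_apply U.isOpen (contDiffOn_of_eq hg) w w' z.2]

theorem commute_dirDerivation {𝕜 E : Type*} [RCLike 𝕜] [NormedAddCommGroup E] [NormedSpace 𝕜 E]
    (U : Opens E) (w w' : E) :
    Function.Commute (dirDerivation 𝕜 U w) (dirDerivation 𝕜 U w') := by
  intro g
  ext z
  simp only [dirDerivation_dirDerivation_apply (apply_eq_extension g)]
  refine ((contDiffOn_extension g).contDiffAt (U.isOpen.mem_nhds z.2)).isSymmSndFDerivAt ?_ w w'
  simpa using WithTop.coe_le_coe.mpr (le_top : (2 : ℕ∞) ≤ ⊤)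

theorem isUnit_of_forall_ne_zero (hg : ∀ z, g.1 z ≠ 0) : IsUnit g := by
  have hinv : ContDiffOn 𝕜 ∞ (fun z => (extension g z)⁻¹) U :=
    (contDiffOn_extension g).inv fun z hz => apply_eq_extension g ⟨z, hz⟩ ▸ hg ⟨z, hz⟩
  refine .of_mul_eq_one (ofContDiffOn _ hinv) ?_
  ext z
  exact (congrArg (g.1 z * ·⁻¹) (apply_eq_extension g z).symm).trans (mul_inv_cancel₀ (hg z))

variable {Φ : E → 𝕜 × 𝕜} {u v : smoothFunctions 𝕜 U}

theorem fderiv_apply_eq (hu : ∀ z : U, u.1 z = (Φ z).1) (hv : ∀ z : U, v.1 z = (Φ z).2)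
    (w : E) (z : U) :
    fderiv 𝕜 Φ z w = ((dirDerivation 𝕜 U w u).1 z, (dirDerivation 𝕜 U w v).1 z) := by
  rw [dirDerivation_apply (G := fun x => (Φ x).1) hu,
    dirDerivation_apply (G := fun x => (Φ x).2) hv]
  exact DFunLike.congr_fun
    ((differentiableAt_of_eq hu z).fderiv_prodMk (differentiableAt_of_eq hv z)) w

theorem fderiv_fderiv_apply_eq (hu : ∀ z : U, u.1 z = (Φ z).1) (hv : ∀ z : U, v.1 z = (Φ z).2)
    (w w' : E) (z : U) : fderiv 𝕜 (fderiv 𝕜 Φ) z w w' =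
      ((dirDerivation 𝕜 U w (dirDerivation 𝕜 U w' u)).1 z,
        (dirDerivation 𝕜 U w (dirDerivation 𝕜 U w' v)).1 z) := by
  rw [fderiv_fderiv_apply U.isOpen ((contDiffOn_of_eq hu).prodMk (contDiffOn_of_eq hv)) w w' z.2]
  exact fderiv_apply_eq (fun z => by rw [fderiv_apply_eq hu hv])
    (fun z => by rw [fderiv_apply_eq hu hv]) w z

end smoothFunctions

end SmoothFunctions

section PointTransformation

open Polynomial TopologicalSpace smoothFunctions

theorem eq_zero_of_forall_eval_eq_zero {K : Type*} [CommRing K] [IsDomain K] [Infinite K]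
    {P Q : K[X]} (hQ : Q ≠ 0) (h : ∀ x, Q.eval x ≠ 0 → P.eval x = 0) : P = 0 := by
  have hPQ : P * Q = 0 := Polynomial.funext fun x => by
    by_cases hx : Q.eval x = 0
    · simp [hx]
    · simp [h x hx]
  exact (mul_eq_zero.mp hPQ).resolve_right hQ

theorem cubic_eq_zero_of_forall {K : Type*} [CommRing K] [IsDomain K] [Infinite K] {P : Cubic K}
    {m n : K} (hmn : m ≠ 0 ∨ n ≠ 0) (h : ∀ p, m + n * p ≠ 0 → P.toPoly.eval p = 0) : P = 0 := by
  have hQ : C m + C n * X ≠ 0 := fun hQ => by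
    have hm := congrArg (coeff · 0) hQ
    have hn := congrArg (coeff · 1) hQ
    simp only [coeff_add, coeff_C_zero, coeff_C_mul, coeff_X_zero, coeff_X_one, coeff_C_succ,
      coeff_zero, mul_zero, mul_one, add_zero, zero_add] at hm hn
    exact hmn.elim (· hm) (· hn)
  exact (Cubic.toPoly_eq_zero_iff P).mp <|
    eq_zero_of_forall_eval_eq_zero hQ fun p hp => h p (by simpa using hp)

theorem cubic_eq_zero_of_forall_map_evalHom {𝕜 E : Type*} [NontriviallyNormedField 𝕜]
    [NormedAddCommGroup E] [NormedSpace 𝕜 E] {U : Opens E} {P : Cubic (smoothFunctions 𝕜 U)}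
    (h : ∀ z, P.map (evalHom z) = 0) : P = 0 := by
  ext z
  · exact congrArg Cubic.a (h z)
  · exact congrArg Cubic.b (h z)
  · exact congrArg Cubic.c (h z)
  · exact congrArg Cubic.d (h z)

variable {𝕜 : Type*} [RCLike 𝕜] {U : Opens (𝕜 × 𝕜)} {Φ : 𝕜 × 𝕜 → 𝕜 × 𝕜}
  {u v f F : smoothFunctions 𝕜 U} {E₁ E₂ : CubicODE 𝕜}

/-- The partial derivative `∂/∂x` on smooth functions in the `(x, y)`-plane. -/
noncomputable abbrev partialX (U : Opens (𝕜 × 𝕜)) :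
    Derivation 𝕜 (smoothFunctions 𝕜 U) (smoothFunctions 𝕜 U) :=
  dirDerivation 𝕜 U (1, 0)

/-- The partial derivative `∂/∂y` on smooth functions in the `(x, y)`-plane. -/
noncomputable abbrev partialY (U : Opens (𝕜 × 𝕜)) :
    Derivation 𝕜 (smoothFunctions 𝕜 U) (smoothFunctions 𝕜 U) :=
  dirDerivation 𝕜 U (0, 1)

theorem dirDerivation_one_mk (U : Opens (𝕜 × 𝕜)) (p : 𝕜) :
    dirDerivation 𝕜 U (1, p) = partialX U + p • partialY U := by
  rw [← map_smul, ← map_add]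
  simp

theorem dirDerivation_zero_mk (U : Opens (𝕜 × 𝕜)) (q : 𝕜) :
    dirDerivation 𝕜 U (0, q) = q • partialY U := by
  rw [← map_smul]
  simp

/-- The coordinate function `x` on an open set of the `(x, y)`-plane. -/
def coordX (U : Opens (𝕜 × 𝕜)) : smoothFunctions 𝕜 U :=
  ofContDiffOn Prod.fst contDiffOn_fst

/-- The coordinate function `y` on an open set of the `(x, y)`-plane. -/
def coordY (U : Opens (𝕜 × 𝕜)) : smoothFunctions 𝕜 U :=
  ofContDiffOn Prod.snd contDiffOn_snd

theorem isCoordinatePair_coordX_coordY (U : Opens (𝕜 × 𝕜)) :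
    IsCoordinatePair (partialX U) (partialY U) (coordX U) (coordY U) := by
  constructor <;> ext z <;>
    simp [coordX, coordY, dirDerivation_ofContDiffOn_apply, fderiv_fst, fderiv_snd]

theorem Transforms.totalDeriv₂_totalDeriv_eq (hT : Transforms Φ U E₁ E₂)
    (hf : ∀ (z : U) p, E₁.rhs z p = f.1 z) (hF : ∀ (z : U) p, E₂.rhs (Φ z) p = F.1 z) (z : U)
    (p : 𝕜) (hp : (totalDeriv Φ z p).1 ≠ 0) :
    (totalDeriv₂ Φ z p (f.1 z)).2 * (totalDeriv Φ z p).1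
      - (totalDeriv Φ z p).2 * (totalDeriv₂ Φ z p (f.1 z)).1 =
    F.1 z * (totalDeriv Φ z p).1 ^ 3 := by
  have hsecond := (hT z z.2 p _ hp).mp (hf z p).symm
  rwa [hF, newSecond, div_eq_iff (pow_ne_zero 3 hp)] at hsecond

section Components

variable (hu : ∀ z : U, u.1 z = (Φ z).1) (hv : ∀ z : U, v.1 z = (Φ z).2)
include hu hv

theorem det_fderiv_eq_jacobian (z : U) :
    (fderiv 𝕜 Φ z).det = (jacobian (partialX U) (partialY U) u v).1 z := by
  rw [ContinuousLinearMap.det, ← LinearMap.det_toMatrix (Module.Basis.finTwoProd 𝕜),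
    Matrix.det_fin_two]
  simp [LinearMap.toMatrix_apply, fderiv_apply_eq hu hv, jacobian]

theorem totalDeriv_eq (z : U) (p : 𝕜) : totalDeriv Φ z p =
    ((partialX U u + p • partialY U u).1 z, (partialX U v + p • partialY U v).1 z) := by
  rw [totalDeriv, fderiv_apply_eq hu hv, dirDerivation_one_mk]
  rfl

theorem totalDeriv₂_eq (z : U) (p q : 𝕜) : totalDeriv₂ Φ z p q =
    ((partialX U (partialX U u) + (2 * p) • partialX U (partialY U u)
        + p ^ 2 • partialY U (partialY U u) + q • partialY U u).1 z,
      (partialX U (partialX U v) + (2 * p) • partialX U (partialY U v)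
        + p ^ 2 • partialY U (partialY U v) + q • partialY U v).1 z) := by
  have hcomm (g : smoothFunctions 𝕜 U) : partialY U (partialX U g) = partialX U (partialY U g) :=
    commute_dirDerivation U _ _ g
  rw [totalDeriv₂, fderiv_apply_eq hu hv, fderiv_fderiv_apply_eq hu hv, dirDerivation_one_mk,
    dirDerivation_zero_mk]
  ext <;> simp only [hcomm, map_add, Derivation.map_smul, Derivation.add_apply,
    Derivation.smul_apply, AddMemClass.coe_add, SetLike.val_smul, Pi.add_apply, Pi.smul_apply,
    smul_eq_mul, Prod.mk_add_mk] <;> ring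

theorem isUnit_jacobian (hΦ : IsPointTransformation Φ U) :
    IsUnit (jacobian (partialX U) (partialY U) u v) :=
  isUnit_of_forall_ne_zero fun z => det_fderiv_eq_jacobian hu hv z ▸ hΦ.det_ne_zero z z.2

theorem Transforms.determiningCubic_eq_zero (hT : Transforms Φ U E₁ E₂)
    (hJ : IsUnit (jacobian (partialX U) (partialY U) u v))
    (hf : ∀ (z : U) p, E₁.rhs z p = f.1 z) (hF : ∀ (z : U) p, E₂.rhs (Φ z) p = F.1 z) :
    determiningCubic (partialX U) (partialY U) u v f F = 0 := by
  refine cubic_eq_zero_of_forall_map_evalHom fun z => ?_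
  refine cubic_eq_zero_of_forall (m := evalHom z (partialX U u)) (n := evalHom z (partialY U u))
    ?_ fun p hp => ?_
  · by_contra! hz
    exact (hJ.map (evalHom z)).ne_zero (by simp [jacobian, hz])
  · have hident := hT.totalDeriv₂_totalDeriv_eq hf hF z p
      (by simpa [totalDeriv_eq hu hv, evalHom_apply, mul_comm] using hp)
    simp only [totalDeriv_eq hu hv, totalDeriv₂_eq hu hv, AddMemClass.coe_add, SetLike.val_smul,
      Pi.add_apply, Pi.smul_apply, smul_eq_mul] at hident
    simp only [Cubic.toPoly, Cubic.map, determiningCubic, jacobian, map_sub, map_mul, map_pow,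
      map_add, map_ofNat, eval_add, eval_mul, eval_sub, eval_C, eval_pow, eval_X, eval_ofNat,
      evalHom_apply]
    linear_combination hident

theorem painleveII_rhs_eq (a : 𝕜) (z : U) (p : 𝕜) :
    (painleveII a).rhs (Φ z) p = (painleveIIRhs u v a).1 z := by
  change _ = evalHom z (painleveIIRhs u v a)
  simp only [painleveIIRhs, map_add, map_mul, map_pow, map_ofNat]
  simp [CubicODE.rhs, painleveII, evalHom_apply, hu, hv]

end Components

end PointTransformation

theorem lemma1 {𝕜 : Type*} [RCLike 𝕜] (a₁ a₂ : 𝕜) (h_pos : a₁ ≠ a₂) (h_neg : a₁ ≠ -a₂) :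
    ¬ PointEquivalent (painleveII a₁) (painleveII a₂) := by
  rintro ⟨U, Φ, ⟨z, hz⟩, hΦ, hT⟩
  lift U to TopologicalSpace.Opens (𝕜 × 𝕜) using hΦ.isOpen
  let u := smoothFunctions.ofContDiffOn _ hΦ.contDiffOn.fst
  let v := smoothFunctions.ofContDiffOn _ hΦ.contDiffOn.snd
  have hu (z : U) : u.1 z = (Φ z).1 := rfl
  have hv (z : U) : v.1 z = (Φ z).2 := rfl
  have hJ := isUnit_jacobian hu hv hΦ
  have h6 : IsUnit (6 : smoothFunctions 𝕜 U) :=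
    (IsUnit.mk0 (6 : 𝕜) (by norm_num)).map (algebraMap 𝕜 _)
  have hcubic := hT.determiningCubic_eq_zero hu hv hJ
    (painleveII_rhs_eq (Φ := id) (u := coordX U) (v := coordY U) (fun _ => rfl) (fun _ => rfl) a₁)
    (painleveII_rhs_eq hu hv a₂)
  have hsq := param_sq_eq_of_determiningCubic_eq_zero hcubic
    (smoothFunctions.commute_dirDerivation U _ _) h6 hJ (isCoordinatePair_coordX_coordY U)
  have hparam : a₁ ^ 2 = a₂ ^ 2 := congrArg (smoothFunctions.evalHom ⟨z, hz⟩) hsq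
  exact (sq_eq_sq_iff_eq_or_eq_neg.mp hparam).elim h_pos h_neg
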